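/- Let $n\ge 0$ and let $G$ be a loopless multigraph on the vertex set $[0,n]=\{0,1,\dots,n\}$, with every edge $(i,j)$, $i<j$, directed from the smaller vertex $i$ to the larger vertex $j$. The copies of a multiple edge are regarded as distinct, and all unions are multiset unions. A *reduction* of $G$ on edges $(i,j),(j,k)\in E(G)$, $i<j<k$, replaces $G$ by the three graphs $G_1,G_2,G_3$ on $[0,n]$ with $E(G_1)=E(G)\setminus\{(j,k)\}\cup\{(i,k)\}$, $E(G_2)=E(G)\setminus\{(i,j)\}\cup\{(i,k)\}$, $E(G_3)=E(G)\setminus\{(i,j),(j,k)\}\cup\{(i,k)\}$ (one copy of each named edge being removed or added). A *reduction tree* of $G$ is a finite tree with root labelled $G$, in which each node is either a leaf whose label admits no reduction, or has exactly three children, labelled by the graphs obtained by one reduction of its label. The *left-degree sequence* of a graph $L$ on $[0,n]$ is $(\mathrm{indeg}_L(1),\dots,\mathrm{indeg}_L(n))$, where $\mathrm{indeg}_L(i)$ is the number of edges of $L$ directed into $i$. Let $G\setminus 0$ be $G$ with the vertex $0$ and its incident edges deleted, and let $G[0,i]$ be the restriction of $G$ to the vertices $[0,i]$. For $F\subseteq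 E(G\setminus 0)$ put $f_{i,j}=\#\{(j,k)\in F: k\le i\}$. Let $\mathrm{Sol}_G(F)$ be the set of all integer arrays with entries $a_{i,j}^{(m)}$, where $1\le j\le i\le n$ and $1\le m\le\max(1,\mu_{j,i})$, $\mu_{j,i}$ being the number of copies of $(j,i)$ in $G$, such that the numbers $b_{i,j}^{(m)}=a_{i,j}^{(m)}+f_{i,j}$ satisfy, for all $1\le j\le n$, - $f_{n,j}\le b_{n,j}^{(1)}$; - for $j<i\le n$: $b_{i,j}^{(1)}\le b_{i,j}^{(2)}\le\cdots\le b_{i,j}^{(\mu)}\le b_{i-1,j}^{(1)}$ if $\mu=\mu_{j,i}\ge1$, and $b_{i,j}^{(1)}=b_{i-1,j}^{(1)}$ if $\mu_{j,i}=0$; - $b_{j,j}^{(1)}=\#E(G[0,j])-\sum_{k=1}^{j-1}b_{j,k}^{(1)}$. The *first column* of such an array is $(a_{n,1}^{(1)},\dots,a_{n,n}^{(1)})$. **Theorem.** $G$ has a reduction tree, and for every reduction tree of $G$ the multiset $\mathrm{LD}(G)$ of the left-degree sequences of its leaves equals the multiset union, over all $F\subseteq E(G\setminus 0)$, of the multisets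 of first columns of the arrays in $\mathrm{Sol}_G(F)$. In particular, $\mathrm{LD}(G)$ does not depend on the choice of the reduction tree. -/

import Mathlib

/-- A loopless multigraph on the vertex set `[0,n]`, every edge being directed from its smaller
endpoint `e.1` to its larger endpoint `e.2`. Edges form a multiset. -/
@[ext]
structure OrderedMultigraph (n : ℕ) where
  edges : Multiset (ℕ × ℕ)
  lt_of_mem : ∀ e ∈ edges, e.1 < e.2
  le_of_mem : ∀ e ∈ edges, e.2 ≤ n

namespace OrderedMultigraph

variable {n : ℕ}

/-- The number of copies of the edge `(j,i)`. -/
def mult (G : OrderedMultigraph n) (j i : ℕ) : ℕ := G.edges.count (j, i)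

/-- The number of edges directed into the vertex `i`. -/
def indeg (G : OrderedMultigraph n) (i : ℕ) : ℕ := (G.edges.filter fun e => e.2 = i).card

/-- The left-degree sequence `(indeg 1, …, indeg n)`; its coordinates are natural numbers,
viewed as integers. -/
def leftDegreeSeq (G : OrderedMultigraph n) : Fin n → ℤ := fun p => (G.indeg (p + 1) : ℤ)

/-- The number of edges of the restriction `G[0,i]` of `G` to the vertices `[0,i]`. -/
def numEdgesUpTo (G : OrderedMultigraph n) (i : ℕ) : ℕ :=
  (G.edges.filter fun e => e.1 ≤ i ∧ e.2 ≤ i).card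

/-- The edges of `G ∖ 0` (delete the vertex `0` and all incident edges), each copy of a multiple
edge being made distinct: an element `((j, i), c)` is the copy number `c` of the edge `(j, i)`,
`0 ≤ c < mult j i`. -/
def edgesAwayFromZero (G : OrderedMultigraph n) : Finset ((ℕ × ℕ) × ℕ) :=
  (G.edges.filter fun e => e.1 ≠ 0 ∧ e.2 ≠ 0).toEnumFinset

/-! ### Reductions and reduction trees -/

theorem lt_of_path (G : OrderedMultigraph n) {i j k : ℕ} (h₁ : (i, j) ∈ G.edges)
    (h₂ : (j, k) ∈ G.edges) : i < k :=
  lt_trans (G.lt_of_mem _ h₁) (G.lt_of_mem _ h₂)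

/-- `E(G₁) = E(G) ∖ {(j,k)} ∪ {(i,k)}`: one copy of `(j,k)` is removed. -/
def reduce₁ (G : OrderedMultigraph n) {i j k : ℕ} (h₁ : (i, j) ∈ G.edges)
    (h₂ : (j, k) ∈ G.edges) : OrderedMultigraph n where
  edges := (i, k) ::ₘ G.edges.erase (j, k)
  lt_of_mem e he := by
    rcases Multiset.mem_cons.1 he with rfl | he
    · exact G.lt_of_path h₁ h₂
    · exact G.lt_of_mem e (Multiset.mem_of_mem_erase he)
  le_of_mem e he := by
    rcases Multiset.mem_cons.1 he with rfl | he
    · exact G.le_of_mem (j, k) h₂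
    · exact G.le_of_mem e (Multiset.mem_of_mem_erase he)

/-- `E(G₂) = E(G) ∖ {(i,j)} ∪ {(i,k)}`. -/
def reduce₂ (G : OrderedMultigraph n) {i j k : ℕ} (h₁ : (i, j) ∈ G.edges)
    (h₂ : (j, k) ∈ G.edges) : OrderedMultigraph n where
  edges := (i, k) ::ₘ G.edges.erase (i, j)
  lt_of_mem e he := by
    rcases Multiset.mem_cons.1 he with rfl | he
    · exact G.lt_of_path h₁ h₂
    · exact G.lt_of_mem e (Multiset.mem_of_mem_erase he)
  le_of_mem e he := by
    rcases Multiset.mem_cons.1 he with rfl | he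
    · exact G.le_of_mem (j, k) h₂
    · exact G.le_of_mem e (Multiset.mem_of_mem_erase he)

/-- `E(G₃) = E(G) ∖ {(i,j), (j,k)} ∪ {(i,k)}`. -/
def reduce₃ (G : OrderedMultigraph n) {i j k : ℕ} (h₁ : (i, j) ∈ G.edges)
    (h₂ : (j, k) ∈ G.edges) : OrderedMultigraph n where
  edges := (i, k) ::ₘ (G.edges.erase (i, j)).erase (j, k)
  lt_of_mem e he := by
    rcases Multiset.mem_cons.1 he with rfl | he
    · exact G.lt_of_path h₁ h₂
    · exact G.lt_of_mem e (Multiset.mem_of_mem_erase (Multiset.mem_of_mem_erase he))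
  le_of_mem e he := by
    rcases Multiset.mem_cons.1 he with rfl | he
    · exact G.le_of_mem (j, k) h₂
    · exact G.le_of_mem e (Multiset.mem_of_mem_erase (Multiset.mem_of_mem_erase he))

/-- `G` can be reduced: it has edges `(i,j)` and `(j,k)` (and then automatically `i < j < k`). -/
def Reducible (G : OrderedMultigraph n) : Prop :=
  ∃ i j k : ℕ, (i, j) ∈ G.edges ∧ (j, k) ∈ G.edges

/-- Reduction trees with root labelled by `G`: either a single leaf, if `G` cannot be reduced, or a
reduction of `G` together with a reduction tree of each of the three resulting graphs. -/
inductive ReductionTree {n : ℕ} : OrderedMultigraph n → Type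
  | leaf (G : OrderedMultigraph n) (h : ¬ G.Reducible) : ReductionTree G
  | node (G : OrderedMultigraph n) (i j k : ℕ) (h₁ : (i, j) ∈ G.edges) (h₂ : (j, k) ∈ G.edges)
      (T₁ : ReductionTree (G.reduce₁ h₁ h₂)) (T₂ : ReductionTree (G.reduce₂ h₁ h₂))
      (T₃ : ReductionTree (G.reduce₃ h₁ h₂)) : ReductionTree G

/-- The multiset of the graphs that label the leaves of a reduction tree. -/
def ReductionTree.leaves {n : ℕ} :
    {G : OrderedMultigraph n} → ReductionTree G → Multiset (OrderedMultigraph n)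
  | _, .leaf G _ => {G}
  | _, .node _ _ _ _ _ _ T₁ T₂ T₃ => T₁.leaves + T₂.leaves + T₃.leaves

/-- The multiset of left-degree sequences of the leaves of a reduction tree. -/
def ReductionTree.LD {G : OrderedMultigraph n} (T : ReductionTree G) : Multiset (Fin n → ℤ) :=
  T.leaves.map leftDegreeSeq

/-! ### Constraint arrays and their solutions -/

/-- The pairs `(i,j)` and copy numbers `m` for which there is a variable `a_{i,j}^{(m)}`: there is
`a_{i,j}^{(1)}` for all `1 ≤ j ≤ i ≤ n`, and a further one for each additional copy of the edge
`(j,i)`. -/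
def IsVar (G : OrderedMultigraph n) (i j m : ℕ) : Prop :=
  1 ≤ j ∧ j ≤ i ∧ i ≤ n ∧ 1 ≤ m ∧ m ≤ max 1 (G.mult j i)

/-- The constraint array of `G`, for the entries `b i j m` and with the constant `c j` at the
leftmost edge of row `j`: for `1 ≤ j ≤ n`, row `j` is
`c j ≤ b_{n,j}^{(1)} ≤ ⋯ ≤ b_{j,j}^{(1)} = #E(G[0,j]) - ∑_{1 ≤ k < j} b_{j,k}^{(1)}`,
where the link between `b_{i+1,j}^{(1)}` and `b_{i,j}^{(1)}` (`j ≤ i < n`) is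
`b_{i+1,j}^{(1)} ≤ b_{i+1,j}^{(2)} ≤ ⋯ ≤ b_{i+1,j}^{(k)} ≤ b_{i,j}^{(1)}` if there are `k ≥ 1` copies
of the edge `(j,i+1)`, and `b_{i+1,j}^{(1)} = b_{i,j}^{(1)}` if there is none. -/
structure Tri (G : OrderedMultigraph n) (c : ℕ → ℤ) (b : ℕ → ℕ → ℕ → ℤ) : Prop where
  left : ∀ j, 1 ≤ j → j ≤ n → c j ≤ b n j 1
  copies : ∀ i j m, 1 ≤ j → j ≤ i → i + 1 ≤ n → 1 ≤ m → m < G.mult j (i + 1) →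
    b (i + 1) j m ≤ b (i + 1) j (m + 1)
  step : ∀ i j, 1 ≤ j → j ≤ i → i + 1 ≤ n → G.mult j (i + 1) ≠ 0 →
    b (i + 1) j (G.mult j (i + 1)) ≤ b i j 1
  eq : ∀ i j, 1 ≤ j → j ≤ i → i + 1 ≤ n → G.mult j (i + 1) = 0 → b (i + 1) j 1 = b i j 1
  diag : ∀ j, 1 ≤ j → j ≤ n →
    b j j 1 = (G.numEdgesUpTo j : ℤ) - ∑ k ∈ Finset.Ico 1 j, b j k 1

/-- `f_{i,j} = #{(j,k) ∈ F : k ≤ i}`. -/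
def shift (F : Finset ((ℕ × ℕ) × ℕ)) (i j : ℕ) : ℕ := (F.filter fun e => e.1.1 = j ∧ e.1.2 ≤ i).card

/-- Integer solution arrays of the constraint array `Tri(F)`, which arises from the array
`Tri(∅)` (where all leftmost constants are `0`) by replacing each `a_{i,j}^{(m)}` by
`a_{i,j}^{(m)} + f_{i,j}` and adding `f_{n,j}` to the leftmost constant of row `j`.
An array is a function of `i j m` that vanishes where there is no variable. -/
structure IsSol (G : OrderedMultigraph n) (F : Finset ((ℕ × ℕ) × ℕ)) (a : ℕ → ℕ → ℕ → ℤ) :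
    Prop where
  eq_zero : ∀ i j m, ¬ G.IsVar i j m → a i j m = 0
  tri : G.Tri (fun j => (shift F n j : ℤ)) (fun i j m => a i j m + (shift F i j : ℤ))

theorem shift_mono (F : Finset ((ℕ × ℕ) × ℕ)) (j : ℕ) {i i' : ℕ} (h : i ≤ i') :
    shift F i j ≤ shift F i' j := by
  apply Finset.card_le_card
  intro e he
  simp only [Finset.mem_filter] at he ⊢
  exact ⟨he.1, he.2.1, he.2.2.trans h⟩

theorem Tri.copies_le {G : OrderedMultigraph n} {c : ℕ → ℤ} {b : ℕ → ℕ → ℕ → ℤ} (h : G.Tri c b)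
    {i j m m' : ℕ} (hj : 1 ≤ j) (hji : j ≤ i) (hi : i + 1 ≤ n) (hm : 1 ≤ m) (hmm : m ≤ m')
    (hm' : m' ≤ G.mult j (i + 1)) : b (i + 1) j m ≤ b (i + 1) j m' := by
  induction m', hmm using Nat.le_induction with
  | base => exact le_rfl
  | succ p hp ih => exact (ih (by omega)).trans (h.copies i j p hj hji hi (by omega) (by omega))

theorem Tri.le_prev {G : OrderedMultigraph n} {c : ℕ → ℤ} {b : ℕ → ℕ → ℕ → ℤ} (h : G.Tri c b)
    {i j m : ℕ} (hj : 1 ≤ j) (hji : j ≤ i) (hi : i + 1 ≤ n) (hm : 1 ≤ m)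
    (hm' : m ≤ max 1 (G.mult j (i + 1))) : b (i + 1) j m ≤ b i j 1 := by
  by_cases h0 : G.mult j (i + 1) = 0
  · have : m = 1 := by simp [h0] at hm'; omega
    subst this
    exact (h.eq i j hj hji hi h0).le
  · exact (h.copies_le hj hji hi hm (by omega) le_rfl).trans (h.step i j hj hji hi h0)

theorem Tri.one_anti {G : OrderedMultigraph n} {c : ℕ → ℤ} {b : ℕ → ℕ → ℕ → ℤ} (h : G.Tri c b)
    {i i' j : ℕ} (hj : 1 ≤ j) (hji : j ≤ i) (hii : i ≤ i') (hi' : i' ≤ n) :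
    b i' j 1 ≤ b i j 1 := by
  induction i', hii using Nat.le_induction with
  | base => exact le_rfl
  | succ p hp ih =>
    exact (h.le_prev hj (hji.trans hp) hi' le_rfl (le_max_left _ _)).trans (ih (by omega))

theorem Tri.one_le {G : OrderedMultigraph n} {c : ℕ → ℤ} {b : ℕ → ℕ → ℕ → ℤ} (h : G.Tri c b)
    {i j m : ℕ} (hv : G.IsVar i j m) : b i j 1 ≤ b i j m ∧ b i j m ≤ b j j 1 := by
  obtain ⟨hj, hji, hi, hm, hm'⟩ := hv
  rcases hji.eq_or_lt with rfl | hlt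
  · have h0 : G.mult j j = 0 := by
      refine Multiset.count_eq_zero.2 fun hmem => ?_
      exact absurd (G.lt_of_mem _ hmem) (lt_irrefl _)
    have : m = 1 := by simp [h0] at hm'; omega
    subst this
    exact ⟨le_rfl, le_rfl⟩
  · obtain ⟨i, rfl⟩ : ∃ p, i = p + 1 := ⟨i - 1, by omega⟩
    refine ⟨?_, (h.le_prev hj (by omega) hi hm hm').trans
      (h.one_anti hj le_rfl (by omega) (by omega))⟩
    rcases hm.eq_or_lt with rfl | hm2
    · exact le_rfl
    · exact h.copies_le hj (by omega) hi le_rfl hm (by omega)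

theorem IsSol.bounds {G : OrderedMultigraph n} {F : Finset ((ℕ × ℕ) × ℕ)} {a : ℕ → ℕ → ℕ → ℤ}
    (h : G.IsSol F a) {i j m : ℕ} (hv : G.IsVar i j m) : 0 ≤ a i j m ∧ a i j m ≤ G.edges.card := by
  have low : ∀ {i j m : ℕ}, G.IsVar i j m → 0 ≤ a i j m := by
    intro i j m hv
    have h1 := (h.tri.one_le hv).1
    have h2 := h.tri.one_anti hv.1 hv.2.1 hv.2.2.1 le_rfl
    have h3 := h.tri.left j hv.1 (hv.2.1.trans hv.2.2.1)
    have h4 : (shift F i j : ℤ) ≤ shift F n j := by exact_mod_cast shift_mono F j hv.2.2.1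
    linarith
  refine ⟨low hv, ?_⟩
  have h1 := (h.tri.one_le hv).2
  have h2 := h.tri.diag j hv.1 (hv.2.1.trans hv.2.2.1)
  have h3 : 0 ≤ ∑ k ∈ Finset.Ico 1 j, (a j k 1 + (shift F j k : ℤ)) := by
    refine Finset.sum_nonneg fun k hk => ?_
    rw [Finset.mem_Ico] at hk
    have := low (i := j) (j := k) (m := 1)
      ⟨hk.1, hk.2.le, hv.2.1.trans hv.2.2.1, le_rfl, le_max_left _ _⟩
    positivity
  have h4 : (G.numEdgesUpTo j : ℤ) ≤ G.edges.card := by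
    exact_mod_cast Multiset.card_le_card (Multiset.filter_le _ _)
  have h5 : (0 : ℤ) ≤ shift F i j := by positivity
  linarith

theorem finite_isSol (G : OrderedMultigraph n) (F : Finset ((ℕ × ℕ) × ℕ)) :
    {a | G.IsSol F a}.Finite := by
  let B : Finset (ℕ × ℕ × ℕ) := Finset.range (n + 1) ×ˢ Finset.range (n + 1) ×ˢ
    Finset.range (G.edges.card + 2)
  let R : {a // G.IsSol F a} → (B → Finset.Icc (0 : ℤ) G.edges.card) := fun a v =>
    ⟨a.1 v.1.1 v.1.2.1 v.1.2.2, by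
      rw [Finset.mem_Icc]
      by_cases hv : G.IsVar v.1.1 v.1.2.1 v.1.2.2
      · exact a.2.bounds hv
      · rw [a.2.eq_zero _ _ _ hv]; simp⟩
  have hR : Function.Injective R := by
    intro a a' haa
    ext i j m
    by_cases hv : G.IsVar i j m
    · have hmem : (i, j, m) ∈ B := by
        have h1 : G.mult j i ≤ G.edges.card := Multiset.count_le_card _ _
        obtain ⟨hj, hji, hi, hm, hm'⟩ := hv
        simp only [B, Finset.mem_product, Finset.mem_range]
        omega
      exact congrArg Subtype.val (congrFun haa ⟨(i, j, m), hmem⟩)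
    · rw [a.2.eq_zero _ _ _ hv, a'.2.eq_zero _ _ _ hv]
  have : Finite ↑{a | G.IsSol F a} := Finite.of_injective R hR
  exact Set.toFinite {a | G.IsSol F a}

/-- `Sol_G(F)`, the (finite) set of all integer solution arrays of `Tri(F)`. -/
noncomputable def Sol (G : OrderedMultigraph n) (F : Finset ((ℕ × ℕ) × ℕ)) :
    Finset (ℕ → ℕ → ℕ → ℤ) :=
  (G.finite_isSol F).toFinset

/-- The first column `(a_{n,1}^{(1)}, …, a_{n,n}^{(1)})` of an array. -/
def firstColumn (n : ℕ) (a : ℕ → ℕ → ℕ → ℤ) : Fin n → ℤ := fun p => a n (p + 1) 1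

end OrderedMultigraph

/-! Put `t_i = s_1 ⋯ s_i`. Weight an edge `(0,i)` by `t_i` and an edge `(j,i)`, `j ≥ 1`, by `X_{ji}
= t_i (1 + t_j) / (t_j - t_i)`, expanded in powers of `t_i / t_j`; in the variables `s` this is a
genuine power series. These weights satisfy `X_{ij} X_{jk} = X_{ik} (X_{ij} + X_{jk} + 1)`
(`edgeSeries_mul`), so the product of the weights of `G` is the sum of the products of its three
reductions, and hence the sum over the leaves of any reduction tree.

Only the coefficients of `t^x` with `x ≥ 0` matter. In a leaf, no edge enters the tail `j ≥ 1` of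
another edge, so every term of `X_{ji} = (t_i / t_j + t_i) ∑ (t_i / t_j)^k` except `t_i` leaves a
negative power of `t_j`. What survives is the single monomial of the left-degree sequence. Thus the
coefficient of `t^x` in the series of `G` is the multiplicity of `x` in `LD` (`count_LD`), whatever
the tree.

Expanding the series of `G` directly, let `F` be the set of edges contributing `t_i / t_j` instead
of `t_i`, and `k e` the power taken from each geometric series. The coefficient then counts pairs
`(F, k)`, where `k` is a flow with net flow `x` (`coeff_seqExp_series`). For fixed `F`, such flows
are exactly the solution arrays with first column `x`: the flows on the edges out of `j` are the
successive differences in row `j`, whose last entry is the inflow at `j` (`bijOn_solOfFlow`).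

Trees exist because every reduction replaces edges by a longer one. -/

namespace OrderedMultigraph

variable {n : ℕ}

/-! ### Existence of reduction trees -/

/-- A quantity that drops under every reduction: the sum over the edges of their defect from the
length `n + 1`. -/
def size (G : OrderedMultigraph n) : ℕ := (G.edges.map fun e => n + 1 - (e.2 - e.1)).sum

theorem erase_mem_of_path (G : OrderedMultigraph n) {i j k : ℕ} (h₁ : (i, j) ∈ G.edges)
    (h₂ : (j, k) ∈ G.edges) : (j, k) ∈ G.edges.erase (i, j) := by
  have h := G.lt_of_mem _ h₁
  refine (Multiset.mem_erase_of_ne fun h' => ?_).2 h₂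
  simp only [Prod.mk.injEq] at h'
  simp only at h
  omega

/-- The new edge is strictly longer than the removed one, and `k ≤ n` keeps the truncated
subtraction exact. -/
theorem size_reduce₁_lt (G : OrderedMultigraph n) {i j k : ℕ} (h₁ : (i, j) ∈ G.edges)
    (h₂ : (j, k) ∈ G.edges) : (G.reduce₁ h₁ h₂).size < G.size := by
  have a := G.lt_of_mem _ h₁
  have b := G.lt_of_mem _ h₂
  have c := G.le_of_mem _ h₂
  have e := congrArg (fun m => (m.map fun e : ℕ × ℕ => n + 1 - (e.2 - e.1)).sum)
    (Multiset.cons_erase h₂)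
  simp only [Multiset.map_cons, Multiset.sum_cons] at a b c e
  simp only [size, reduce₁, Multiset.map_cons, Multiset.sum_cons]
  omega

theorem size_reduce₂_lt (G : OrderedMultigraph n) {i j k : ℕ} (h₁ : (i, j) ∈ G.edges)
    (h₂ : (j, k) ∈ G.edges) : (G.reduce₂ h₁ h₂).size < G.size := by
  have a := G.lt_of_mem _ h₁
  have b := G.lt_of_mem _ h₂
  have c := G.le_of_mem _ h₂
  have e := congrArg (fun m => (m.map fun e : ℕ × ℕ => n + 1 - (e.2 - e.1)).sum)
    (Multiset.cons_erase h₁)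
  simp only [Multiset.map_cons, Multiset.sum_cons] at a b c e
  simp only [size, reduce₂, Multiset.map_cons, Multiset.sum_cons]
  omega

theorem size_reduce₃_lt (G : OrderedMultigraph n) {i j k : ℕ} (h₁ : (i, j) ∈ G.edges)
    (h₂ : (j, k) ∈ G.edges) : (G.reduce₃ h₁ h₂).size < G.size := by
  have a := G.lt_of_mem _ h₁
  have b := G.lt_of_mem _ h₂
  have c := G.le_of_mem _ h₂
  have e := congrArg (fun m => (m.map fun e : ℕ × ℕ => n + 1 - (e.2 - e.1)).sum)
    (Multiset.cons_erase h₁)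
  have e' := congrArg (fun m => (m.map fun e : ℕ × ℕ => n + 1 - (e.2 - e.1)).sum)
    (Multiset.cons_erase (G.erase_mem_of_path h₁ h₂))
  simp only [Multiset.map_cons, Multiset.sum_cons] at a b c e e'
  simp only [size, reduce₃, Multiset.map_cons, Multiset.sum_cons]
  omega

theorem nonempty_reductionTree (G : OrderedMultigraph n) : Nonempty (ReductionTree G) := by
  induction hs : G.size using Nat.strong_induction_on generalizing G with
  | _ s ih =>
    subst hs
    by_cases h : G.Reducible
    · obtain ⟨i, j, k, h₁, h₂⟩ := h
      obtain ⟨T₁⟩ := ih _ (G.size_reduce₁_lt h₁ h₂) _ rfl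
      obtain ⟨T₂⟩ := ih _ (G.size_reduce₂_lt h₁ h₂) _ rfl
      obtain ⟨T₃⟩ := ih _ (G.size_reduce₃_lt h₁ h₂) _ rfl
      exact ⟨.node G i j k h₁ h₂ T₁ T₂ T₃⟩
    · exact ⟨.leaf G h⟩

/-! ### Edge series -/

/-- The exponent of `t_i / t_j = s_{j+1} ⋯ s_i`, where `t_i = s_1 ⋯ s_i`. -/
noncomputable def ratioExp (j i : ℕ) : ℕ →₀ ℕ := ∑ l ∈ Finset.Ioc j i, Finsupp.single l 1

theorem ratioExp_apply (j i l : ℕ) : ratioExp j i l = if j < l ∧ l ≤ i then 1 else 0 := by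
  simp [ratioExp, Finsupp.finsetSum_apply, Finsupp.single_apply]

theorem ratioExp_add {i j k : ℕ} (h : i ≤ j) (h' : j ≤ k) :
    ratioExp i j + ratioExp j k = ratioExp i k := by
  ext l
  simp only [Finsupp.add_apply, ratioExp_apply]
  split_ifs <;> omega

theorem ratioExp_ne_zero {j i : ℕ} (h : j < i) : ratioExp j i ≠ 0 := by
  intro h0
  have := DFunLike.congr_fun h0 i
  simp [ratioExp_apply, h] at this

/-- Since `s_l = t_l / t_{l-1}`, the exponent of `t_l` in `s^d` is `d l - d (l + 1)`. This is how
exponents in `t` are read off throughout. -/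
theorem ratioExp_diff {j i l : ℕ} (h : j ≤ i) :
    (ratioExp j i l : ℤ) - ratioExp j i (l + 1) =
      (if i = l then 1 else 0) - (if j = l then 1 else 0) := by
  simp only [ratioExp_apply]
  split_ifs <;> omega

/-- The geometric series `∑ k, s ^ (k v)`. -/
noncomputable def geom (v : ℕ →₀ ℕ) : MvPowerSeries ℕ ℤ :=
  open Classical in fun d => if ∃ k : ℕ, d = k • v then 1 else 0

open Classical in
theorem coeff_geom (v d : ℕ →₀ ℕ) :
    MvPowerSeries.coeff d (geom v) = if ∃ k : ℕ, d = k • v then 1 else 0 := rfl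

theorem geom_mul_one_sub {v : ℕ →₀ ℕ} (hv : v ≠ 0) :
    geom v * (1 - MvPowerSeries.monomial v 1) = 1 := by
  classical
  ext d
  rw [mul_sub, mul_one, map_sub, MvPowerSeries.coeff_mul_monomial, MvPowerSeries.coeff_one,
    coeff_geom, coeff_geom, mul_one]
  by_cases h0 : d = 0
  · subst h0
    have : ¬ v ≤ 0 := fun h => hv (le_antisymm h (zero_le))
    have h1 : ∃ k : ℕ, (0 : ℕ →₀ ℕ) = k • v := ⟨0, by simp⟩
    simp only [this, h1, if_true, if_false, sub_zero]
  · rw [if_neg h0]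
    by_cases h : ∃ k : ℕ, d = k • v
    · obtain ⟨k, rfl⟩ := h
      obtain ⟨k, rfl⟩ : ∃ p, k = p + 1 := by
        cases k with
        | zero => simp at h0
        | succ p => exact ⟨p, rfl⟩
      have h1 : v ≤ (k + 1) • v := by rw [succ_nsmul]; exact le_add_self
      have h2 : ∃ q : ℕ, (k + 1) • v - v = q • v := ⟨k, by rw [succ_nsmul, add_tsub_cancel_right]⟩
      have h3 : ∃ q : ℕ, (k + 1) • v = q • v := ⟨_, rfl⟩
      rw [if_pos h1, if_pos h2, if_pos h3, sub_self]
    · rw [if_neg h]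
      by_cases h1 : v ≤ d
      · rw [if_pos h1, if_neg, sub_zero]
        rintro ⟨q, hq⟩
        exact h ⟨q + 1, by rw [succ_nsmul, ← hq, tsub_add_cancel_of_le h1]⟩
      · rw [if_neg h1, sub_zero]

/-- The series of an edge: `t_i` for `(0,i)`, and for `(j,i)` with `j ≥ 1` the expansion of
`t_i (1 + t_j) / (t_j - t_i)`. -/
noncomputable def edgeSeries (e : ℕ × ℕ) : MvPowerSeries ℕ ℤ :=
  if e.1 = 0 then MvPowerSeries.monomial (ratioExp 0 e.2) 1
  else (MvPowerSeries.monomial (ratioExp e.1 e.2) 1 + MvPowerSeries.monomial (ratioExp 0 e.2) 1) *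
    geom (ratioExp e.1 e.2)

theorem monomial_ratioExp_mul {i j k : ℕ} (h : i ≤ j) (h' : j ≤ k) :
    MvPowerSeries.monomial (ratioExp i j) (1 : ℤ) * MvPowerSeries.monomial (ratioExp j k) 1 =
      MvPowerSeries.monomial (ratioExp i k) 1 := by
  rw [MvPowerSeries.monomial_mul_monomial, ratioExp_add h h', mul_one]

/-- An identity of rational functions in `t_i, t_j, t_k`. The three summands on the right match the
three graphs of a reduction. -/
theorem edgeSeries_mul {i j k : ℕ} (hij : i < j) (hjk : j < k) :
    edgeSeries (i, j) * edgeSeries (j, k) =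
      edgeSeries (i, k) * (edgeSeries (i, j) + edgeSeries (j, k) + 1) := by
  have hj : j ≠ 0 := by omega
  have g2 := geom_mul_one_sub (ratioExp_ne_zero hjk)
  have t2 := monomial_ratioExp_mul (Nat.zero_le j) hjk.le
  by_cases hi : i = 0
  · subst hi
    simp only [edgeSeries, hj, if_true, if_false]
    rw [← t2]
    set u := MvPowerSeries.monomial (ratioExp j k) (1 : ℤ)
    set t := MvPowerSeries.monomial (ratioExp 0 j) (1 : ℤ)
    set g := geom (ratioExp j k)
    linear_combination (t * u + t * t * u) * g2
  · have g1 := geom_mul_one_sub (ratioExp_ne_zero hij)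
    have g3 := geom_mul_one_sub (ratioExp_ne_zero (hij.trans hjk))
    have t1 := monomial_ratioExp_mul (Nat.zero_le i) hij.le
    have t3 := monomial_ratioExp_mul hij.le hjk.le
    simp only [edgeSeries, hj, hi, if_false]
    rw [← t3] at g3 ⊢
    rw [← t2, ← t1]
    set u := MvPowerSeries.monomial (ratioExp j k) (1 : ℤ)
    set t := MvPowerSeries.monomial (ratioExp 0 i) (1 : ℤ)
    set w := MvPowerSeries.monomial (ratioExp i j) (1 : ℤ)
    set a := geom (ratioExp i j)
    set b := geom (ratioExp j k)
    set c := geom (ratioExp i k)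
    have ne : ∀ {p q : MvPowerSeries ℕ ℤ}, p * q = 1 → q ≠ 0 := by
      rintro p q h rfl; simp at h
    -- The denominators are nonzero because they are invertible, so they may be cleared in the
    -- domain of power series.
    refine mul_right_cancel₀ (ne g1) (mul_right_cancel₀ (ne g2) (mul_right_cancel₀ (ne g3) ?_))
    have e1 : (w + t * w) * a * ((u + t * w * u) * b) * (1 - w) * (1 - u) * (1 - w * u) =
        (w + t * w) * (u + t * w * u) * (1 - w * u) * (a * (1 - w)) * (b * (1 - u)) := by ring
    have e2 : (w * u + t * w * u) * c * ((w + t * w) * a + (u + t * w * u) * b + 1) * (1 - w) *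
        (1 - u) * (1 - w * u) = (w * u + t * w * u) * (c * (1 - w * u)) *
        ((w + t * w) * (a * (1 - w)) * (1 - u) + (u + t * w * u) * (b * (1 - u)) * (1 - w) +
          (1 - w) * (1 - u)) := by ring
    rw [e1, e2, g1, g2, g3]
    ring

/-- The product of the edge series over all edges of `G`. -/
noncomputable def series (G : OrderedMultigraph n) : MvPowerSeries ℕ ℤ :=
  (G.edges.map edgeSeries).prod

theorem series_eq_add_of_path (G : OrderedMultigraph n) {i j k : ℕ} (h₁ : (i, j) ∈ G.edges)
    (h₂ : (j, k) ∈ G.edges) :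
    G.series = (G.reduce₁ h₁ h₂).series + (G.reduce₂ h₁ h₂).series +
      (G.reduce₃ h₁ h₂).series := by
  obtain ⟨m, hm⟩ := Multiset.exists_cons_of_mem (G.erase_mem_of_path h₁ h₂)
  have hG : G.edges = (i, j) ::ₘ (j, k) ::ₘ m := by rw [← hm, Multiset.cons_erase h₁]
  have h := edgeSeries_mul (G.lt_of_mem _ h₁) (G.lt_of_mem _ h₂)
  have e1 : G.edges.erase (j, k) = (i, j) ::ₘ m := by
    rw [hG, Multiset.cons_swap, Multiset.erase_cons_head]
  simp only [series, reduce₁, reduce₂, reduce₃, e1, hm, Multiset.erase_cons_head]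
  simp only [hG, Multiset.map_cons, Multiset.prod_cons]
  linear_combination (m.map edgeSeries).prod * h

/-! ### Coefficients of products of geometric series -/

/-- One term `s ^ (k e • v e)` is chosen from each factor; `v e ≠ 0` lets `k e` be recovered from
the chosen exponent, so distinct `k` give distinct choices. -/
theorem coeff_prod_geom {ι : Type*} (s : Finset ι) (v : ι → ℕ →₀ ℕ)
    (hv : ∀ e ∈ s, v e ≠ 0) (d : ℕ →₀ ℕ) :
    MvPowerSeries.coeff d (∏ e ∈ s, geom (v e)) =
      ({k : ι →₀ ℕ | k.support ⊆ s ∧ ∑ e ∈ s, k e • v e = d}.ncard : ℤ) := by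
  classical
  rw [MvPowerSeries.coeff_prod]
  simp only [coeff_geom, Finset.prod_boole]
  rw [Finset.sum_boole]
  congr 1
  rw [← Set.ncard_coe_finset]
  symm
  refine Set.ncard_congr (fun k hk => Finsupp.onFinset s (fun e => k e • v e) (fun e he => by
        by_contra h
        exact he (by simp only [Finsupp.notMem_support_iff.1 fun h' => h (hk.1 h'),
          zero_smul]))) ?_ ?_ ?_
  · rintro k ⟨hk, hsum⟩
    simp only [Finset.coe_filter, Set.mem_ofPred_eq, Finset.mem_finsuppAntidiag]
    exact ⟨⟨hsum, Finsupp.support_onFinset_subset⟩, fun e _ => ⟨k e, rfl⟩⟩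
  · rintro k k' hk hk' h
    ext e
    by_cases he : e ∈ s
    · have := DFunLike.congr_fun h e
      simp only [Finsupp.onFinset_apply] at this
      obtain ⟨l, hl⟩ : ∃ l, v e l ≠ 0 := by
        by_contra! h0
        exact hv e he (Finsupp.ext h0)
      have := DFunLike.congr_fun this l
      simp only [Finsupp.smul_apply, smul_eq_mul] at this
      exact Nat.eq_of_mul_eq_mul_right (Nat.pos_of_ne_zero hl) this
    · rw [Finsupp.notMem_support_iff.1 fun h' => he (hk.1 h'),
        Finsupp.notMem_support_iff.1 fun h' => he (hk'.1 h')]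
  · intro l hl
    simp only [Finset.coe_filter, Set.mem_ofPred_eq, Finset.mem_finsuppAntidiag] at hl
    obtain ⟨⟨hsum, hsupp⟩, hl⟩ := hl
    choose! q hq using hl
    have hq' : ∀ e, (Finsupp.onFinset s (fun e => if e ∈ s then q e else 0)
      (fun e he => by by_contra h; simp [h] at he) : ι →₀ ℕ) e = if e ∈ s then q e else 0 :=
        fun _ => rfl
    refine ⟨Finsupp.onFinset s (fun e => if e ∈ s then q e else 0)
      (fun e he => by by_contra h; simp [h] at he), ⟨Finsupp.support_onFinset_subset, ?_⟩, ?_⟩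
    · rw [← hsum]
      refine Finset.sum_congr rfl fun e he => ?_
      rw [hq', if_pos he, ← hq e he]
    · ext1 e
      rw [Finsupp.onFinset_apply, hq']
      by_cases he : e ∈ s
      · rw [if_pos he, ← hq e he]
      · rw [if_neg he, zero_smul, Finsupp.notMem_support_iff.1 fun h' => he (hsupp h')]

/-! ### Sums over labelled edges -/

theorem sum_toEnumFinset {α M : Type*} [DecidableEq α] [AddCommMonoid M] (m : Multiset α)
    (f : α → M) : ∑ e ∈ m.toEnumFinset, f e.1 = (m.map f).sum := by
  conv_rhs => rw [← Multiset.map_toEnumFinset_fst m, Multiset.map_map]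
  rfl

theorem prod_toEnumFinset {α M : Type*} [DecidableEq α] [CommMonoid M] (m : Multiset α)
    (f : α → M) : ∏ e ∈ m.toEnumFinset, f e.1 = (m.map f).prod := by
  conv_rhs => rw [← Multiset.map_toEnumFinset_fst m, Multiset.map_map]
  rfl

theorem mem_edgesAwayFromZero {G : OrderedMultigraph n} {e : (ℕ × ℕ) × ℕ} :
    e ∈ G.edgesAwayFromZero ↔ e.1.1 ≠ 0 ∧ e.2 < G.mult e.1.1 e.1.2 := by
  rw [edgesAwayFromZero, Multiset.mem_toEnumFinset, Multiset.count_filter, mult]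
  by_cases h : e.1.1 = 0
  · simp [h]
  · by_cases h' : e.1.2 = 0
    · have : Multiset.count e.1 G.edges = 0 := Multiset.count_eq_zero.2 fun hm => by
        have := G.lt_of_mem _ hm
        omega
      simp [h', h]
      have h3 : (e.1.1, 0) = e.1 := by rw [← h']
      rw [h3, this]; simp
    · simp [h, h']

theorem mem_edges_of_mem {G : OrderedMultigraph n} {e : (ℕ × ℕ) × ℕ}
    (he : e ∈ G.edgesAwayFromZero) : e.1 ∈ G.edges := by
  have h := (mem_edgesAwayFromZero.1 he).2
  exact Multiset.count_pos.1 (lt_of_le_of_lt (Nat.zero_le _) h)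

theorem bounds_of_mem {G : OrderedMultigraph n} {e : (ℕ × ℕ) × ℕ}
    (he : e ∈ G.edgesAwayFromZero) : 1 ≤ e.1.1 ∧ e.1.1 < e.1.2 ∧ e.1.2 ≤ n :=
  ⟨Nat.one_le_iff_ne_zero.2 (mem_edgesAwayFromZero.1 he).1, G.lt_of_mem _ (mem_edges_of_mem he),
    G.le_of_mem _ (mem_edges_of_mem he)⟩

theorem edgesAwayFromZero_eq (G : OrderedMultigraph n) :
    G.edgesAwayFromZero = (G.edges.filter fun e => e.1 ≠ 0).toEnumFinset := by
  unfold edgesAwayFromZero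
  congr 1
  refine Multiset.filter_congr fun e he => ?_
  have := G.lt_of_mem e he
  omega

theorem sum_edges (G : OrderedMultigraph n) {M : Type*} [AddCommMonoid M] (f : ℕ × ℕ → M) :
    (G.edges.map f).sum =
      ((G.edges.filter fun e => e.1 = 0).map f).sum + ∑ e ∈ G.edgesAwayFromZero, f e.1 := by
  rw [edgesAwayFromZero_eq, sum_toEnumFinset, ← Multiset.sum_add, ← Multiset.map_add,
    Multiset.filter_add_not]

theorem prod_edges (G : OrderedMultigraph n) {M : Type*} [CommMonoid M] (f : ℕ × ℕ → M) :
    (G.edges.map f).prod =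
      ((G.edges.filter fun e => e.1 = 0).map f).prod * ∏ e ∈ G.edgesAwayFromZero, f e.1 := by
  rw [edgesAwayFromZero_eq, prod_toEnumFinset, ← Multiset.prod_add, ← Multiset.map_add,
    Multiset.filter_add_not]

theorem indeg_eq_sum (G : OrderedMultigraph n) (l : ℕ) :
    (G.indeg l : ℤ) = (G.edges.map fun e => if e.2 = l then (1 : ℤ) else 0).sum := by
  rw [indeg]
  induction G.edges using Multiset.induction_on with
  | empty => simp
  | cons a m ih =>
    by_cases h : a.2 = l
    · simp [h, ← ih, add_comm]
    · simp [h, ← ih]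

/-! ### Coefficients of the series of a graph as numbers of flows -/

/-- The exponent of the factor of `G.series` that comes from the choice of the first summand of
`s_{j+1} ⋯ s_i + s_1 ⋯ s_i` for the edges `(j,i)` in `F`, and of the second one otherwise. -/
noncomputable def baseExp (G : OrderedMultigraph n) (F : Finset ((ℕ × ℕ) × ℕ)) : ℕ →₀ ℕ :=
  ((G.edges.filter fun e => e.1 = 0).map fun e => ratioExp 0 e.2).sum +
    (∑ e ∈ F, ratioExp e.1.1 e.1.2 + ∑ e ∈ G.edgesAwayFromZero \ F, ratioExp 0 e.1.2)

theorem prod_monomial {ι : Type*} (s : Finset ι) (v : ι → ℕ →₀ ℕ) :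
    ∏ e ∈ s, MvPowerSeries.monomial (v e) (1 : ℤ) =
      MvPowerSeries.monomial (∑ e ∈ s, v e) 1 := by
  classical
  induction s using Finset.induction_on with
  | empty => rfl
  | insert a s ha ih =>
    rw [Finset.prod_insert ha, Finset.sum_insert ha, ih, MvPowerSeries.monomial_mul_monomial,
      mul_one]

/-- The subsets `F` of the theorem arise here, from multiplying out the two-term numerators of the
edges away from `0`. -/
theorem series_eq_sum (G : OrderedMultigraph n) :
    G.series = ∑ F ∈ G.edgesAwayFromZero.powerset, MvPowerSeries.monomial (G.baseExp F) 1 *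
      ∏ e ∈ G.edgesAwayFromZero, geom (ratioExp e.1.1 e.1.2) := by
  rw [series, prod_edges]
  have h0 : ((G.edges.filter fun e => e.1 = 0).map edgeSeries).prod =
      MvPowerSeries.monomial
        ((G.edges.filter fun e => e.1 = 0).map fun e => ratioExp 0 e.2).sum 1 := by
    induction G.edges using Multiset.induction_on with
    | empty => rfl
    | cons a m ih =>
      by_cases h : a.1 = 0
      · simp [h, ih, edgeSeries, MvPowerSeries.monomial_mul_monomial]
      · simpa [h] using ih
  have h1 : ∏ e ∈ G.edgesAwayFromZero, edgeSeries e.1 =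
      ∏ e ∈ G.edgesAwayFromZero, (MvPowerSeries.monomial (ratioExp e.1.1 e.1.2) 1 +
        MvPowerSeries.monomial (ratioExp 0 e.1.2) 1) * geom (ratioExp e.1.1 e.1.2) :=
    Finset.prod_congr rfl fun e he => by rw [edgeSeries, if_neg (mem_edgesAwayFromZero.1 he).1]
  rw [h0, h1, Finset.prod_mul_distrib, Finset.prod_add, Finset.sum_mul, Finset.mul_sum]
  refine Finset.sum_congr rfl fun F _ => ?_
  rw [prod_monomial, prod_monomial, ← mul_assoc, MvPowerSeries.monomial_mul_monomial,
    MvPowerSeries.monomial_mul_monomial, mul_one, mul_one, baseExp]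

theorem coeff_series (G : OrderedMultigraph n) (d : ℕ →₀ ℕ) :
    MvPowerSeries.coeff d G.series = ∑ F ∈ G.edgesAwayFromZero.powerset,
      ({k : (ℕ × ℕ) × ℕ →₀ ℕ | k.support ⊆ G.edgesAwayFromZero ∧
        G.baseExp F + ∑ e ∈ G.edgesAwayFromZero, k e • ratioExp e.1.1 e.1.2 = d}.ncard : ℤ) := by
  classical
  rw [series_eq_sum, map_sum]
  refine Finset.sum_congr rfl fun F _ => ?_
  rw [MvPowerSeries.coeff_monomial_mul]
  split_ifs with h
  · rw [one_mul, coeff_prod_geom _ _ fun e he => ratioExp_ne_zero (bounds_of_mem he).2.1]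
    refine congrArg (fun s : Set ((ℕ × ℕ) × ℕ →₀ ℕ) => (s.ncard : ℤ)) (Set.ext fun k => ?_)
    simp only [Set.mem_ofPred_eq]
    rw [eq_tsub_iff_add_eq_of_le h, add_comm]
  · symm
    rw [Nat.cast_eq_zero]
    refine (congrArg Set.ncard (Set.eq_empty_iff_forall_notMem.2 ?_)).trans (Set.ncard_empty _)
    rintro k ⟨_, hk⟩
    exact h (hk ▸ le_self_add)

/-- The flow into the vertex `j`, where each edge `(i,j)` carries one more unit than `k` says. -/
def inflow (G : OrderedMultigraph n) (k : (ℕ × ℕ) × ℕ →₀ ℕ) (j : ℕ) : ℤ :=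
  G.indeg j + ∑ e ∈ G.edgesAwayFromZero with e.1.2 = j, (k e : ℤ)

/-- The flows on the edges away from `0` with net flow `x`, where each edge in `F` takes one more
unit out of its smaller endpoint than `k` says. -/
def flows (G : OrderedMultigraph n) (F : Finset ((ℕ × ℕ) × ℕ)) (x : Fin n → ℤ) :
    Set ((ℕ × ℕ) × ℕ →₀ ℕ) :=
  {k | k.support ⊆ G.edgesAwayFromZero ∧ ∀ p : Fin n, x p = G.inflow k ((p : ℕ) + 1) -
    ∑ e ∈ G.edgesAwayFromZero with e.1.1 = (p : ℕ) + 1, (k e : ℤ) -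
      shift F n ((p : ℕ) + 1)}

/-- The exponent in the variables `s` of the monomial `∏ t_{p+1} ^ (x p)`. -/
noncomputable def seqExp (x : Fin n → ℤ) : ℕ →₀ ℕ := ∑ p, (x p).toNat • ratioExp 0 (p + 1)

/-- The exponents of the `t_l` are the successive differences of those of the `s_l`, and conversely
they determine `d` once it vanishes at `0` and beyond `n`. -/
theorem eq_seqExp_iff {x : Fin n → ℤ} (hx : ∀ p, 0 ≤ x p) (d : ℕ →₀ ℕ) (h0 : d 0 = 0)
    (hn : ∀ l, n < l → d l = 0) :
    d = seqExp x ↔ ∀ p : Fin n, x p = d (p + 1) - d (p + 2) := by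
  have key : ∀ q : Fin n, (seqExp x (q + 1) : ℤ) - seqExp x (q + 2) = x q := by
    intro q
    simp only [seqExp, Finsupp.finsetSum_apply, Finsupp.smul_apply, smul_eq_mul]
    push_cast
    rw [← Finset.sum_sub_distrib, Finset.sum_eq_single q]
    · rw [← mul_sub, ratioExp_diff (Nat.zero_le _), Int.toNat_of_nonneg (hx q)]
      simp
    · intro p _ hp
      rw [← mul_sub, ratioExp_diff (Nat.zero_le _)]
      have : (p : ℕ) ≠ q := fun h => hp (Fin.ext h)
      simp [this]
    · simp
  have hs : ∀ l, l = 0 ∨ n < l → seqExp x l = 0 := by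
    intro l hl
    simp only [seqExp, Finsupp.finsetSum_apply, Finsupp.smul_apply, smul_eq_mul]
    refine Finset.sum_eq_zero fun p _ => ?_
    rw [ratioExp_apply, if_neg (by omega), mul_zero]
  constructor
  · rintro rfl p
    exact (key p).symm
  · intro h
    ext l
    by_cases hl : l = 0 ∨ n < l
    · rw [hs l hl]
      rcases hl with rfl | hl
      · exact h0
      · exact hn l hl
    · push Not at hl
      obtain ⟨hl0, hl⟩ := hl
      -- Downward induction from `n + 1`, where both exponents vanish.
      have : l ≤ n + 1 := by omega
      clear hl
      induction this using Nat.decreasingInduction with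
      | self => rw [hn _ (by omega), hs _ (by omega)]
      | of_succ l hl' ih =>
        obtain ⟨q, rfl⟩ : ∃ q, l = q + 1 := ⟨l - 1, by omega⟩
        have h1 := key ⟨q, by omega⟩
        have h2 := h ⟨q, by omega⟩
        have h3 := ih (by omega)
        simp only at h1 h2
        rw [show q + 1 + 1 = q + 2 by omega] at h3
        rw [h3] at h2
        omega

theorem shift_eq_sum {G : OrderedMultigraph n} {F : Finset ((ℕ × ℕ) × ℕ)}
    (hF : F ⊆ G.edgesAwayFromZero) (l : ℕ) :
    (shift F n l : ℤ) = ∑ e ∈ F, if e.1.1 = l then (1 : ℤ) else 0 := by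
  rw [shift, Finset.sum_boole]
  congr 2
  exact Finset.filter_congr fun e he => and_iff_left (bounds_of_mem (hF he)).2.2

/-- Every edge, in `F` or not, contributes one `t` at its head, which gives the in-degree; only the
edges of `F` also divide by the `t` of their tail. -/
theorem baseExp_diff (G : OrderedMultigraph n) {F : Finset ((ℕ × ℕ) × ℕ)}
    (hF : F ⊆ G.edgesAwayFromZero) {l : ℕ} (hl : 1 ≤ l) :
    (G.baseExp F l : ℤ) - G.baseExp F (l + 1) = G.indeg l - shift F n l := by
  have hz : ∀ l,
      ((((G.edges.filter fun e => e.1 = 0).map fun e => ratioExp 0 e.2).sum l : ℕ) : ℤ) =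
      ((G.edges.filter fun e => e.1 = 0).map fun e => (ratioExp 0 e.2 l : ℤ)).sum := by
    intro l
    induction (G.edges.filter fun e => e.1 = 0) using Multiset.induction_on with
    | empty => simp
    | cons a m ih => simp [ih]
  have hz' : ((G.edges.filter fun e => e.1 = 0).map fun e => (ratioExp 0 e.2 l : ℤ)).sum -
      ((G.edges.filter fun e => e.1 = 0).map fun e => (ratioExp 0 e.2 (l + 1) : ℤ)).sum =
      ((G.edges.filter fun e => e.1 = 0).map fun e => if e.2 = l then (1 : ℤ) else 0).sum := by
    rw [← Multiset.sum_map_sub]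
    congr 1
    refine Multiset.map_congr rfl fun e _ => ?_
    rw [ratioExp_diff (Nat.zero_le _), if_neg (by omega : ¬ 0 = l), sub_zero]
  have hF1 : (∑ e ∈ F, (ratioExp e.1.1 e.1.2 l : ℤ)) -
      ∑ e ∈ F, (ratioExp e.1.1 e.1.2 (l + 1) : ℤ) =
      (∑ e ∈ F, if e.1.2 = l then (1 : ℤ) else 0) - ∑ e ∈ F, if e.1.1 = l then (1 : ℤ) else 0 := by
    rw [← Finset.sum_sub_distrib, ← Finset.sum_sub_distrib]
    exact Finset.sum_congr rfl fun e he => ratioExp_diff (bounds_of_mem (hF he)).2.1.le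
  have hF2 : (∑ e ∈ G.edgesAwayFromZero \ F, (ratioExp 0 e.1.2 l : ℤ)) -
      ∑ e ∈ G.edgesAwayFromZero \ F, (ratioExp 0 e.1.2 (l + 1) : ℤ) =
      ∑ e ∈ G.edgesAwayFromZero \ F, if e.1.2 = l then (1 : ℤ) else 0 := by
    rw [← Finset.sum_sub_distrib]
    refine Finset.sum_congr rfl fun e _ => ?_
    rw [ratioExp_diff (Nat.zero_le _), if_neg (by omega : ¬ 0 = l), sub_zero]
  have hs := Finset.sum_sdiff hF (f := fun e => if e.1.2 = l then (1 : ℤ) else 0)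
  rw [indeg_eq_sum, sum_edges, shift_eq_sum hF]
  simp only [baseExp, Finsupp.add_apply, Finsupp.finsetSum_apply]
  push_cast
  rw [hz, hz]
  linarith

theorem baseExp_eq_zero (G : OrderedMultigraph n) {F : Finset ((ℕ × ℕ) × ℕ)}
    (hF : F ⊆ G.edgesAwayFromZero) {l : ℕ} (hl : l = 0 ∨ n < l) : G.baseExp F l = 0 := by
  have hz : ((G.edges.filter fun e => e.1 = 0).map fun e => ratioExp 0 e.2).sum l = 0 := by
    have := G.le_of_mem
    revert this
    induction G.edges using Multiset.induction_on with
    | empty => simp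
    | cons a m ih =>
      intro this
      have ih := ih fun e he => this e (Multiset.mem_cons_of_mem he)
      have ha := this a (Multiset.mem_cons_self _ _)
      by_cases h : a.1 = 0
      · simp only [h, Multiset.filter_cons_of_pos, Multiset.map_cons, Multiset.sum_cons,
          Finsupp.add_apply, ih, add_zero, ratioExp_apply]
        rw [if_neg (by omega)]
      · simpa [h] using ih
  simp only [baseExp, Finsupp.add_apply, Finsupp.finsetSum_apply, hz, zero_add]
  rw [Finset.sum_eq_zero (s := F), Finset.sum_eq_zero, add_zero]
  · intro e he
    have := bounds_of_mem (Finset.sdiff_subset he)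
    rw [ratioExp_apply, if_neg (by omega)]
  · intro e he
    have := bounds_of_mem (hF he)
    rw [ratioExp_apply, if_neg (by omega)]

theorem coeff_seqExp_series (G : OrderedMultigraph n) {x : Fin n → ℤ} (hx : ∀ p, 0 ≤ x p) :
    MvPowerSeries.coeff (seqExp x) G.series =
      ∑ F ∈ G.edgesAwayFromZero.powerset, ((G.flows F x).ncard : ℤ) := by
  rw [coeff_series]
  refine Finset.sum_congr rfl fun F hF => ?_
  rw [Finset.mem_powerset] at hF
  refine congrArg (fun s : Set ((ℕ × ℕ) × ℕ →₀ ℕ) => (s.ncard : ℤ)) (Set.ext fun k => ?_)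
  simp only [flows, Set.mem_ofPred_eq]
  refine and_congr_right fun _ => ?_
  have hk : ∀ l, l = 0 ∨ n < l →
      (∑ e ∈ G.edgesAwayFromZero, k e • ratioExp e.1.1 e.1.2) l = 0 := by
    intro l hl
    rw [Finsupp.finsetSum_apply]
    refine Finset.sum_eq_zero fun e he => ?_
    have := bounds_of_mem he
    rw [Finsupp.smul_apply, ratioExp_apply, if_neg (by omega), smul_zero]
  rw [eq_seqExp_iff hx]
  · refine forall_congr' fun p => ?_
    have h1 := G.baseExp_diff hF (l := p + 1) (by omega)
    have h2 : ((∑ e ∈ G.edgesAwayFromZero, k e • ratioExp e.1.1 e.1.2) (p + 1 : ℕ) : ℤ) -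
        (∑ e ∈ G.edgesAwayFromZero, k e • ratioExp e.1.1 e.1.2) (p + 2 : ℕ) =
        ∑ e ∈ G.edgesAwayFromZero with e.1.2 = (p : ℕ) + 1, (k e : ℤ) -
        ∑ e ∈ G.edgesAwayFromZero with e.1.1 = (p : ℕ) + 1, (k e : ℤ) := by
      rw [Finsupp.finsetSum_apply, Finsupp.finsetSum_apply, Finset.sum_filter, Finset.sum_filter,
        Nat.cast_sum, Nat.cast_sum, ← Finset.sum_sub_distrib, ← Finset.sum_sub_distrib]
      refine Finset.sum_congr rfl fun e he => ?_
      have := ratioExp_diff (l := p + 1) (bounds_of_mem he).2.1.le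
      rw [Finsupp.smul_apply, Finsupp.smul_apply, smul_eq_mul, smul_eq_mul, Nat.cast_mul,
        Nat.cast_mul, ← mul_sub, this, mul_sub]
      simp only [mul_ite, mul_one, mul_zero]
    rw [inflow, Finsupp.add_apply, Finsupp.add_apply, Nat.cast_add, Nat.cast_add]
    rw [show (p : ℕ) + 1 + 1 = p + 2 by omega] at h1
    constructor <;> intro h <;> linarith
  · rw [Finsupp.add_apply, hk _ (.inl rfl), G.baseExp_eq_zero hF (.inl rfl)]
  · intro l hl
    rw [Finsupp.add_apply, hk _ (.inr hl), G.baseExp_eq_zero hF (.inr hl)]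

/-! ### Flows on graphs without reductions -/

theorem inflow_eq_zero_of_not_reducible {G : OrderedMultigraph n} (h : ¬ G.Reducible)
    {e : (ℕ × ℕ) × ℕ} (he : e ∈ G.edgesAwayFromZero) (k : (ℕ × ℕ) × ℕ →₀ ℕ) :
    G.inflow k e.1.1 = 0 := by
  have key : ∀ e' ∈ G.edges, e'.2 ≠ e.1.1 := fun e' he' h' =>
    h ⟨e'.1, e.1.1, e.1.2, h' ▸ he', mem_edges_of_mem he⟩
  rw [inflow, indeg, Multiset.filter_eq_nil.2 key, Finset.sum_eq_zero]
  · simp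
  · intro e' he'
    rw [Finset.mem_filter] at he'
    exact absurd he'.2 (key _ (mem_edges_of_mem he'.1))

/-- At the tail of an edge away from `0` nothing flows in, so the net flow is minus the outflow
(including the units from `F`); being nonnegative, it forces all of these to vanish. -/
theorem eq_zero_of_mem_flows {G : OrderedMultigraph n} (h : ¬ G.Reducible)
    {F : Finset ((ℕ × ℕ) × ℕ)} (hF : F ⊆ G.edgesAwayFromZero) {x : Fin n → ℤ}
    (hx : ∀ p, 0 ≤ x p) {k : (ℕ × ℕ) × ℕ →₀ ℕ} (hk : k ∈ G.flows F x) : F = ∅ ∧ k = 0 := by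
  have key : ∀ e ∈ G.edgesAwayFromZero, k e = 0 ∧ e ∉ F := by
    intro e he
    have hb := bounds_of_mem he
    obtain ⟨p, hp⟩ : ∃ p : Fin n, (p : ℕ) + 1 = e.1.1 := ⟨⟨e.1.1 - 1, by omega⟩, by simp; omega⟩
    have h1 := hk.2 p
    have h2 := hx p
    rw [hp, inflow_eq_zero_of_not_reducible h he] at h1
    have h3 : (k e : ℤ) ≤ ∑ e' ∈ G.edgesAwayFromZero with e'.1.1 = e.1.1, (k e' : ℤ) :=
      Finset.single_le_sum (f := fun e' => (k e' : ℤ)) (fun _ _ => by positivity)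
        (Finset.mem_filter.2 ⟨he, rfl⟩)
    refine ⟨by omega, fun heF => ?_⟩
    have h4 : 0 < shift F n e.1.1 :=
      Finset.card_pos.2 ⟨e, Finset.mem_filter.2 ⟨heF, rfl, hb.2.2⟩⟩
    omega
  constructor
  · exact Finset.eq_empty_of_forall_notMem fun e he => (key e (hF he)).2 he
  · ext e
    by_cases he : e ∈ G.edgesAwayFromZero
    · exact (key e he).1
    · exact Finsupp.notMem_support_iff.1 fun h' => he (hk.1 h')

theorem zero_mem_flows_iff {G : OrderedMultigraph n} {x : Fin n → ℤ} :
    0 ∈ G.flows ∅ x ↔ G.leftDegreeSeq = x := by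
  simp [flows, inflow, shift, leftDegreeSeq, funext_iff, eq_comm]

theorem sum_ncard_flows_of_not_reducible {G : OrderedMultigraph n} (h : ¬ G.Reducible)
    {x : Fin n → ℤ} (hx : ∀ p, 0 ≤ x p) :
    ∑ F ∈ G.edgesAwayFromZero.powerset, ((G.flows F x).ncard : ℤ) =
      if G.leftDegreeSeq = x then 1 else 0 := by
  rw [Finset.sum_eq_single ∅]
  · split_ifs with hxl
    · have : G.flows ∅ x = {0} := by
        refine Set.eq_singleton_iff_unique_mem.2 ⟨zero_mem_flows_iff.2 hxl, fun k hk => ?_⟩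
        exact (eq_zero_of_mem_flows h (Finset.empty_subset _) hx hk).2
      rw [this, Set.ncard_singleton, Nat.cast_one]
    · have : G.flows ∅ x = ∅ := by
        refine Set.eq_empty_iff_forall_notMem.2 fun k hk => hxl ?_
        have := (eq_zero_of_mem_flows h (Finset.empty_subset _) hx hk).2
        exact zero_mem_flows_iff.1 (this ▸ hk)
      rw [this, Set.ncard_empty, Nat.cast_zero]
  · intro F hF hF0
    have : G.flows F x = ∅ := Set.eq_empty_iff_forall_notMem.2 fun k hk =>
      hF0 (eq_zero_of_mem_flows h (Finset.mem_powerset.1 hF) hx hk).1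
    rw [this, Set.ncard_empty, Nat.cast_zero]
  · intro h'
    exact absurd (Finset.empty_mem_powerset _) h'

/-- Both sides add up over the three children of a node and agree on leaves. The right side involves
only the root. -/
theorem count_LD {G : OrderedMultigraph n} (T : ReductionTree G) {x : Fin n → ℤ}
    (hx : ∀ p, 0 ≤ x p) :
    (T.LD.count x : ℤ) = MvPowerSeries.coeff (seqExp x) G.series := by
  induction T with
  | leaf G h =>
    rw [coeff_seqExp_series G hx, sum_ncard_flows_of_not_reducible h hx]
    simp [ReductionTree.LD, ReductionTree.leaves, Multiset.count_singleton, eq_comm]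
  | node G i j k h₁ h₂ T₁ T₂ T₃ ih₁ ih₂ ih₃ =>
    rw [series_eq_add_of_path G h₁ h₂, map_add, map_add, ← ih₁, ← ih₂, ← ih₃]
    simp [ReductionTree.LD, ReductionTree.leaves]

/-! ### Arrays with given differences -/

/-- The rows of the array `b` are determined by their last entries and by the differences `k e` of
successive entries, and its columns have the sums that the constraint array prescribes. -/
structure IsFlowArray (G : OrderedMultigraph n) (k : (ℕ × ℕ) × ℕ →₀ ℕ) (b : ℕ → ℕ → ℕ → ℤ) :
    Prop where
  copies : ∀ i j m, 1 ≤ j → j ≤ i → i + 1 ≤ n → 1 ≤ m → m < G.mult j (i + 1) →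
    b (i + 1) j (m + 1) = b (i + 1) j m + k ((j, i + 1), m - 1)
  step : ∀ i j, 1 ≤ j → j ≤ i → i + 1 ≤ n → G.mult j (i + 1) ≠ 0 →
    b i j 1 = b (i + 1) j (G.mult j (i + 1)) + k ((j, i + 1), G.mult j (i + 1) - 1)
  eq : ∀ i j, 1 ≤ j → j ≤ i → i + 1 ≤ n → G.mult j (i + 1) = 0 → b (i + 1) j 1 = b i j 1
  diag : ∀ j, 1 ≤ j → j ≤ n →
    b j j 1 = (G.numEdgesUpTo j : ℤ) - ∑ k ∈ Finset.Ico 1 j, b j k 1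

theorem mult_self (G : OrderedMultigraph n) (j : ℕ) : G.mult j j = 0 :=
  Multiset.count_eq_zero.2 fun hmem => absurd (G.lt_of_mem _ hmem) (lt_irrefl _)

/-- The entries are determined recursively: rows in increasing order of `j`, each from its diagonal
entry, which depends on earlier rows only, back towards column `n`. -/
theorem IsFlowArray.eq_of_isVar {G : OrderedMultigraph n} {k : (ℕ × ℕ) × ℕ →₀ ℕ}
    {b b' : ℕ → ℕ → ℕ → ℤ} (h : G.IsFlowArray k b) (h' : G.IsFlowArray k b') {i j m : ℕ}
    (hv : G.IsVar i j m) : b i j m = b' i j m := by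
  induction j using Nat.strong_induction_on generalizing i m with
  | _ j ihj =>
    obtain ⟨hj, hji, hi, hm, hm'⟩ := hv
    induction i, hji using Nat.le_induction generalizing m with
    | base =>
      rw [mult_self] at hm'
      obtain rfl : m = 1 := by omega
      rw [h.diag j hj hi, h'.diag j hj hi]
      congr 1
      refine Finset.sum_congr rfl fun l hl => ?_
      rw [Finset.mem_Ico] at hl
      exact ihj l hl.2 ⟨hl.1, hl.2.le, hi, le_rfl, le_max_left _ _⟩
    | succ i hji ihi =>
      have ihi := ihi (m := 1) (by omega) le_rfl (le_max_left _ _)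
      by_cases h0 : G.mult j (i + 1) = 0
      · obtain rfl : m = 1 := by omega
        rw [h.eq i j hj hji hi h0, h'.eq i j hj hji hi h0, ihi]
      · have hm'' : m ≤ G.mult j (i + 1) := by omega
        clear hm'
        induction hm'' using Nat.decreasingInduction with
        | self =>
          have h1 := h.step i j hj hji hi h0
          have h2 := h'.step i j hj hji hi h0
          linarith
        | of_succ m hlt ih =>
          have h1 := h.copies i j m hj hji hi hm hlt
          have h2 := h'.copies i j m hj hji hi hm hlt
          have := ih (by omega)
          linarith

theorem IsFlowArray.congr {G : OrderedMultigraph n} {k : (ℕ × ℕ) × ℕ →₀ ℕ}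
    {b b' : ℕ → ℕ → ℕ → ℤ} (h : G.IsFlowArray k b)
    (hb : ∀ i j m, G.IsVar i j m → b' i j m = b i j m) : G.IsFlowArray k b' where
  copies i j m h1 h2 h3 h4 h5 := by
    rw [hb _ _ _ ⟨h1, by omega, h3, by omega, by omega⟩,
      hb _ _ _ ⟨h1, by omega, h3, by omega, by omega⟩]
    exact h.copies i j m h1 h2 h3 h4 h5
  step i j h1 h2 h3 h4 := by
    rw [hb _ _ _ ⟨h1, by omega, by omega, by omega, by omega⟩,
      hb _ _ _ ⟨h1, by omega, h3, by omega, by omega⟩]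
    exact h.step i j h1 h2 h3 h4
  eq i j h1 h2 h3 h4 := by
    rw [hb i j 1 ⟨h1, by omega, by omega, by omega, by omega⟩,
      hb (i + 1) j 1 ⟨h1, by omega, h3, by omega, by omega⟩]
    exact h.eq i j h1 h2 h3 h4
  diag j h1 h2 := by
    rw [hb _ _ _ ⟨h1, by omega, h2, by omega, by omega⟩, h.diag j h1 h2]
    congr 1
    refine Finset.sum_congr rfl fun l hl => ?_
    rw [Finset.mem_Ico] at hl
    rw [hb _ _ _ ⟨hl.1, by omega, h2, by omega, by omega⟩]

theorem IsFlowArray.tri {G : OrderedMultigraph n} {k : (ℕ × ℕ) × ℕ →₀ ℕ}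
    {b : ℕ → ℕ → ℕ → ℤ} (h : G.IsFlowArray k b) {c : ℕ → ℤ}
    (hc : ∀ j, 1 ≤ j → j ≤ n → c j ≤ b n j 1) : G.Tri c b where
  left := hc
  copies i j m h1 h2 h3 h4 h5 := by
    have := h.copies i j m h1 h2 h3 h4 h5
    omega
  step i j h1 h2 h3 h4 := by
    have := h.step i j h1 h2 h3 h4
    omega
  eq := h.eq
  diag := h.diag

theorem Tri.exists_isFlowArray {G : OrderedMultigraph n} {c : ℕ → ℤ} {b : ℕ → ℕ → ℕ → ℤ}
    (h : G.Tri c b) :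
    ∃ k : (ℕ × ℕ) × ℕ →₀ ℕ, k.support ⊆ G.edgesAwayFromZero ∧ G.IsFlowArray k b := by
  -- Copies are numbered from `0` and entries from `1`, so copy `c` of `(j,i)` sits between entry `c
  -- + 1` and its successor, which for the last copy is the entry `(i - 1, j, 1)`. The inequalities
  -- of `Tri` make `toNat` harmless.
  let q : (ℕ × ℕ) × ℕ → ℕ := fun e => if e ∈ G.edgesAwayFromZero then
    (if e.2 + 1 < G.mult e.1.1 e.1.2 then b e.1.2 e.1.1 (e.2 + 2) - b e.1.2 e.1.1 (e.2 + 1)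
      else b (e.1.2 - 1) e.1.1 1 - b e.1.2 e.1.1 (e.2 + 1)).toNat else 0
  have hq : ∀ e, q e ≠ 0 → e ∈ G.edgesAwayFromZero := fun e he => by
    by_contra h'
    exact he (if_neg h')
  refine ⟨Finsupp.onFinset G.edgesAwayFromZero q hq, Finsupp.support_onFinset_subset, ?_, ?_,
    h.eq, h.diag⟩
  · intro i j m h1 h2 h3 h4 h5
    have hmem : ((j, i + 1), m - 1) ∈ G.edgesAwayFromZero :=
      mem_edgesAwayFromZero.2 ⟨by simp only; omega, by simp only; omega⟩
    have h6 := h.copies i j m h1 h2 h3 h4 h5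
    obtain ⟨m, rfl⟩ : ∃ p, m = p + 1 := ⟨m - 1, by omega⟩
    rw [Nat.add_sub_cancel] at hmem
    simp only [Finsupp.onFinset_apply, q, if_pos hmem, Nat.add_sub_cancel, if_pos h5]
    rw [Int.toNat_of_nonneg (by linarith)]
    ring
  · intro i j h1 h2 h3 h4
    have h6 := h.step i j h1 h2 h3 h4
    obtain ⟨m, hm⟩ : ∃ p, G.mult j (i + 1) = p + 1 := ⟨G.mult j (i + 1) - 1, by omega⟩
    have hmem : ((j, i + 1), m) ∈ G.edgesAwayFromZero :=
      mem_edgesAwayFromZero.2 ⟨by simp only; omega, by simp only; omega⟩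
    rw [hm] at h6 ⊢
    simp only [Finsupp.onFinset_apply, q, Nat.add_sub_cancel, if_pos hmem, hm, lt_irrefl, if_false]
    rw [Int.toNat_of_nonneg (by linarith)]
    ring

/-! ### The array of a flow -/

/-- The edges whose flow leads from the last entry of row `j` to the entry `(i, j, m)`. -/
def edgesAfter (G : OrderedMultigraph n) (i j m : ℕ) : Finset ((ℕ × ℕ) × ℕ) :=
  G.edgesAwayFromZero.filter fun e => e.1.1 = j ∧ (e.1.2 < i ∨ e.1.2 = i ∧ m ≤ e.2 + 1)

/-- The array with differences `k`, whose row `j` ends with the flow into `j`. -/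
def flowArray (G : OrderedMultigraph n) (k : (ℕ × ℕ) × ℕ →₀ ℕ) (i j m : ℕ) : ℤ :=
  G.inflow k j - ∑ e ∈ G.edgesAfter i j m, (k e : ℤ)

theorem sum_indeg (G : OrderedMultigraph n) (j : ℕ) :
    ∑ l ∈ Finset.Ico 1 (j + 1), (G.indeg l : ℤ) = G.numEdgesUpTo j := by
  rw [← Nat.cast_sum, Nat.cast_inj]
  have := G.lt_of_mem
  unfold indeg numEdgesUpTo
  revert this
  induction G.edges using Multiset.induction_on with
  | empty => simp
  | cons a m ih =>
    intro this
    have ih := ih fun e he => this e (Multiset.mem_cons_of_mem he)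
    have ha := this a (Multiset.mem_cons_self _ _)
    simp only [Multiset.filter_cons, Multiset.card_add, Finset.sum_add_distrib, ih]
    congr 1
    simp only [apply_ite Multiset.card, Multiset.card_singleton, Multiset.card_zero,
      Finset.sum_ite_eq, Finset.mem_Ico]
    split_ifs <;> omega

/-- The flow on an edge with head at most `j` is counted positively at its head and negatively at
its tail, and edges with larger head do not occur. Only the in-degrees remain. This is the diagonal
condition. -/
theorem sum_flowArray (G : OrderedMultigraph n) (k : (ℕ × ℕ) × ℕ →₀ ℕ) (j : ℕ) :
    ∑ l ∈ Finset.Ico 1 (j + 1), G.flowArray k j l 1 = G.numEdgesUpTo j := by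
  simp only [flowArray, inflow, edgesAfter]
  rw [Finset.sum_sub_distrib, Finset.sum_add_distrib, sum_indeg, add_sub_assoc, add_eq_left,
    sub_eq_zero]
  simp only [Finset.sum_filter]
  rw [Finset.sum_comm, Finset.sum_comm (s := Finset.Ico 1 (j + 1))]
  refine Finset.sum_congr rfl fun e he => ?_
  have := bounds_of_mem he
  simp only [ite_and, Finset.sum_ite_eq, Finset.mem_Ico]
  split_ifs <;> first | rfl | omega

theorem isFlowArray_flowArray (G : OrderedMultigraph n) (k : (ℕ × ℕ) × ℕ →₀ ℕ) :
    G.IsFlowArray k (G.flowArray k) where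
  copies i j m h1 h2 h3 h4 h5 := by
    have : G.edgesAfter (i + 1) j m =
        insert ((j, i + 1), m - 1) (G.edgesAfter (i + 1) j (m + 1)) := by
      ext ⟨⟨a, b⟩, c⟩
      simp only [edgesAfter, Finset.mem_filter, Finset.mem_insert, mem_edgesAwayFromZero,
        Prod.mk.injEq]
      grind
    rw [flowArray, flowArray, this, Finset.sum_insert]
    · ring
    · simp [edgesAfter]; omega
  step i j h1 h2 h3 h4 := by
    have : G.edgesAfter (i + 1) j (G.mult j (i + 1)) =
        insert ((j, i + 1), G.mult j (i + 1) - 1) (G.edgesAfter i j 1) := by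
      ext ⟨⟨a, b⟩, c⟩
      simp only [edgesAfter, Finset.mem_filter, Finset.mem_insert, mem_edgesAwayFromZero,
        Prod.mk.injEq]
      grind
    rw [flowArray, flowArray, this, Finset.sum_insert]
    · ring
    · simp [edgesAfter]
  eq i j h1 h2 h3 h4 := by
    have : G.edgesAfter (i + 1) j 1 = G.edgesAfter i j 1 := by
      ext ⟨⟨a, b⟩, c⟩
      simp only [edgesAfter, Finset.mem_filter, mem_edgesAwayFromZero]
      grind
    rw [flowArray, flowArray, this]
  diag j h1 _ := by
    rw [← sum_flowArray G k j, Finset.sum_Ico_succ_top h1]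
    ring

/-- In column `n` all edges out of `j` have been subtracted, so the entry is the inflow minus the
flow `k` out of `j`. -/
theorem flowArray_first (G : OrderedMultigraph n) (k : (ℕ × ℕ) × ℕ →₀ ℕ) (j : ℕ) :
    G.flowArray k n j 1 =
      G.inflow k j - ∑ e ∈ G.edgesAwayFromZero with e.1.1 = j, (k e : ℤ) := by
  have : G.edgesAfter n j 1 = G.edgesAwayFromZero.filter fun e => e.1.1 = j := by
    refine Finset.filter_congr fun e he => and_iff_left ?_
    have := bounds_of_mem he
    omega
  rw [flowArray, this]

theorem IsFlowArray.apply_eq {G : OrderedMultigraph n} {k k' : (ℕ × ℕ) × ℕ →₀ ℕ}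
    {b b' : ℕ → ℕ → ℕ → ℤ} (h : G.IsFlowArray k b) (h' : G.IsFlowArray k' b')
    (hb : ∀ i j m, G.IsVar i j m → b i j m = b' i j m) {e : (ℕ × ℕ) × ℕ}
    (he : e ∈ G.edgesAwayFromZero) : k e = k' e := by
  have hbd := bounds_of_mem he
  have hlt := (mem_edgesAwayFromZero.1 he).2
  have h' := h'.congr hb
  obtain ⟨⟨j, i⟩, c⟩ := e
  obtain ⟨i, rfl⟩ : ∃ p, i = p + 1 := ⟨i - 1, by simp only at hbd; omega⟩
  simp only at hbd hlt
  by_cases hc : c + 1 < G.mult j (i + 1)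
  · have h1 := h.copies i j (c + 1) (by omega) (by omega) (by omega) (by omega) hc
    have h2 := h'.copies i j (c + 1) (by omega) (by omega) (by omega) (by omega) hc
    simp only [Nat.add_sub_cancel] at h1 h2
    omega
  · have h1 := h.step i j (by omega) (by omega) (by omega) (by omega)
    have h2 := h'.step i j (by omega) (by omega) (by omega) (by omega)
    have h3 : G.mult j (i + 1) - 1 = c := by omega
    rw [h3] at h1 h2
    omega

/-- The solution array of a flow. -/
noncomputable def solOfFlow (G : OrderedMultigraph n) (F : Finset ((ℕ × ℕ) × ℕ))
    (k : (ℕ × ℕ) × ℕ →₀ ℕ) (i j m : ℕ) : ℤ :=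
  open Classical in if G.IsVar i j m then G.flowArray k i j m - shift F i j else 0

theorem solOfFlow_of_isVar {G : OrderedMultigraph n} (F : Finset ((ℕ × ℕ) × ℕ))
    (k : (ℕ × ℕ) × ℕ →₀ ℕ) {i j m : ℕ} (hv : G.IsVar i j m) :
    G.solOfFlow F k i j m = G.flowArray k i j m - shift F i j := if_pos hv

theorem isVar_first (G : OrderedMultigraph n) {j : ℕ} (hj : 1 ≤ j) (hj' : j ≤ n) :
    G.IsVar n j 1 := ⟨hj, hj', le_rfl, le_rfl, le_max_left _ _⟩

/-- The inverse takes successive differences of `a + f`. The first column is the net flow `x`, so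
the leftmost inequalities `f_{n,j} ≤ b_{n,j}` say precisely that `x ≥ 0`. -/
theorem bijOn_solOfFlow (G : OrderedMultigraph n) (F : Finset ((ℕ × ℕ) × ℕ)) {x : Fin n → ℤ}
    (hx : ∀ p, 0 ≤ x p) :
    Set.BijOn (G.solOfFlow F) (G.flows F x) {a | G.IsSol F a ∧ firstColumn n a = x} := by
  refine ⟨?_, ?_, ?_⟩
  · rintro k ⟨hk, hkx⟩
    have hfirst : ∀ p : Fin n, G.flowArray k n (p + 1) 1 - shift F n (p + 1) = x p := fun p => by
      rw [flowArray_first, hkx p]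
    refine ⟨⟨fun i j m hv => if_neg hv, ?_⟩, ?_⟩
    · refine ((G.isFlowArray_flowArray k).congr fun i j m hv => ?_).tri ?_
      · rw [solOfFlow_of_isVar F k hv]
        ring
      · intro j h1 h2
        rw [solOfFlow_of_isVar F k (G.isVar_first h1 h2)]
        obtain ⟨p, rfl⟩ : ∃ p : Fin n, j = (p : ℕ) + 1 := ⟨⟨j - 1, by omega⟩, by simp; omega⟩
        have h3 := hfirst p
        have h4 := hx p
        linarith
    · ext p
      rw [firstColumn, solOfFlow_of_isVar F k (G.isVar_first (by omega) (by omega)), hfirst]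
  · intro k hk k' hk' h
    ext e
    by_cases he : e ∈ G.edgesAwayFromZero
    · refine (G.isFlowArray_flowArray k).apply_eq (G.isFlowArray_flowArray k') ?_ he
      intro i j m hv
      have := congrFun (congrFun (congrFun h i) j) m
      rw [solOfFlow_of_isVar F k hv, solOfFlow_of_isVar F k' hv] at this
      linarith
    · rw [Finsupp.notMem_support_iff.1 fun h' => he (hk.1 h'),
        Finsupp.notMem_support_iff.1 fun h' => he (hk'.1 h')]
  · rintro a ⟨ha, rfl⟩
    obtain ⟨k, hk, hka⟩ := ha.tri.exists_isFlowArray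
    -- An array is determined by its differences, so `a + f` is the array of the flow `k` at every
    -- variable.
    have hv : ∀ {i j m}, G.IsVar i j m → a i j m = G.flowArray k i j m - shift F i j :=
      fun hv => eq_sub_of_add_eq (hka.eq_of_isVar (G.isFlowArray_flowArray k) hv)
    refine ⟨k, ⟨hk, fun p => ?_⟩, ?_⟩
    · rw [firstColumn, hv (G.isVar_first (by omega) (by omega)), flowArray_first]
    · ext i j m
      by_cases h : G.IsVar i j m
      · rw [solOfFlow_of_isVar F k h, hv h]
      · rw [ha.eq_zero i j m h]
        exact if_neg h

/-! ### Comparison of multiplicities -/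

theorem count_map_firstColumn (G : OrderedMultigraph n) (F : Finset ((ℕ × ℕ) × ℕ))
    {x : Fin n → ℤ} (hx : ∀ p, 0 ≤ x p) :
    ((G.Sol F).val.map (firstColumn n)).count x = (G.flows F x).ncard := by
  classical
  rw [(G.bijOn_solOfFlow F hx).ncard_eq, Multiset.count_map, ← Finset.filter_val, Finset.card_val,
    ← Set.ncard_coe_finset]
  congr 1
  ext a
  simp [Sol, eq_comm]

theorem firstColumn_nonneg {G : OrderedMultigraph n} {F : Finset ((ℕ × ℕ) × ℕ)}
    {a : ℕ → ℕ → ℕ → ℤ} (ha : G.IsSol F a) (p : Fin n) : 0 ≤ firstColumn n a p :=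
  (ha.bounds (G.isVar_first (by omega) (by omega))).1

theorem LD_eq_sum {G : OrderedMultigraph n} (T : ReductionTree G) :
    T.LD = ∑ F ∈ G.edgesAwayFromZero.powerset, (G.Sol F).val.map (firstColumn n) := by
  ext x
  by_cases hx : ∀ p, 0 ≤ x p
  · rw [← Nat.cast_inj (R := ℤ), count_LD T hx, coeff_seqExp_series G hx, Multiset.count_sum',
      Nat.cast_sum]
    exact Finset.sum_congr rfl fun F _ => by rw [count_map_firstColumn G F hx]
  -- A sequence with a negative coordinate lies in neither multiset: in-degrees and first columns
  -- are nonnegative.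
  · rw [Multiset.count_eq_zero.2, Multiset.count_eq_zero.2]
    · intro h
      obtain ⟨F, _, h⟩ := Multiset.mem_sum.1 h
      obtain ⟨a, ha, rfl⟩ := Multiset.mem_map.1 h
      exact hx (firstColumn_nonneg ((G.finite_isSol F).mem_toFinset.1 ha))
    · intro h
      obtain ⟨L, _, rfl⟩ := Multiset.mem_map.1 h
      exact hx fun p => Int.natCast_nonneg _

end OrderedMultigraph

theorem theoremA (n : ℕ) (G : OrderedMultigraph n) :
    Nonempty (OrderedMultigraph.ReductionTree G) ∧
    (∀ T : OrderedMultigraph.ReductionTree G,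
      T.LD = ∑ F ∈ G.edgesAwayFromZero.powerset,
        (G.Sol F).val.map (OrderedMultigraph.firstColumn n)) ∧
    (∀ T T' : OrderedMultigraph.ReductionTree G, T.LD = T'.LD) :=
  ⟨G.nonempty_reductionTree, fun T => OrderedMultigraph.LD_eq_sum T, fun T T' =>
    (OrderedMultigraph.LD_eq_sum T).trans (OrderedMultigraph.LD_eq_sum T').symm⟩
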